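/- **Definitions.** For $A,B\subseteq\omega$ write $A\subseteq^* B$ if $A\setminus B$ is finite. The principle $\Diamond(\mathfrak b)$ is the assertion: for every $F:2^{<\omega_1}\to\omega^\omega$ such that $F\restriction 2^\delta$ is Borel for every $\delta<\omega_1$, there is $g:\omega_1\to\omega^\omega$ such that for every $f\in 2^{\omega_1}$ the set $$\{\delta<\omega_1 : F(f\restriction\delta)(n)<g(\delta)(n)\text{ for infinitely many } n\}$$ is stationary in $\omega_1$. An open cover $\mathcal U$ of a topological space $X$ is an $\omega$-cover if $X\notin\mathcal U$ and every finite subset of $X$ is contained in some member of $\mathcal U$; it is a $\gamma$-cover if it is infinite and each $x\in X$ belongs to all but finitely many members of $\mathcal U$. A $\gamma$-set is a separable metrizable space in which every $\omega$-cover contains a $\gamma$-subcover. **Theorem.** $\Diamond(\mathfrak b)$ implies that there is an uncountable $\gamma$-set. More precisely, if $\Diamond(\mathfrak b)$ holds, then there are infinite sets $x_\alpha\subseteq\omega$ $(\alpha<\omega_1)$ with $x_\beta\subseteq^* x_\alpha$ whenever $\alpha<\beta<\omega_1$, such that $$X=[\omega]^{<\omega}\cup\{x_\alpha:\alpha<\omega_1\},$$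 regarded, via characteristic functions, as a subspace of the Cantor space $2^\omega$, is an uncountable $\gamma$-set. -/

import Mathlib

namespace GammaBorel

open scoped Ordinal

/-- The well-ordered set `ω₁` of all countable ordinals. For `δ : Omega1`, the ordinal `δ` is
identified with its set of predecessors `Set.Iio δ`. -/
abbrev Omega1 : Type := (ω₁ : Ordinal.{0}).ToType

/-- The guessing principle `◇(𝔟)`. The map `F : 2^{<ω₁} → ω^ω` is given through its restrictions
`F δ` to `2^δ`. The σ-algebras on `2^δ` and on `ω^ω` are the product σ-algebras; since `δ` and `ω`
are countable, these are the Borel σ-algebras of the product topologies, so `Measurable (F δ)` says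
that the restriction is Borel. -/
def DiamondB : Prop :=
  ∀ F : (δ : Omega1) → (Set.Iio δ → Bool) → (ℕ → ℕ),
    (∀ δ, Measurable (F δ)) →
    ∃ g : Omega1 → (ℕ → ℕ), ∀ f : Omega1 → Bool,
      IsStationary {δ : Omega1 |
        {n : ℕ | F δ (fun ξ : Set.Iio δ => f ξ) n < g δ n}.Infinite}

/-- `𝒰` is an open cover of the space `X`. -/
def IsOpenCover {X : Type*} [TopologicalSpace X] (𝒰 : Set (Set X)) : Prop :=
  (∀ U ∈ 𝒰, IsOpen U) ∧ ⋃₀ 𝒰 = Set.univ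

/-- An open cover of `X` is an `ω`-cover if every finite subset of `X` is contained in one of its
members and `X` itself is not a member. -/
def IsOmegaCover {X : Type*} [TopologicalSpace X] (𝒰 : Set (Set X)) : Prop :=
  IsOpenCover 𝒰 ∧ (∀ F : Set X, F.Finite → ∃ U ∈ 𝒰, F ⊆ U) ∧ Set.univ ∉ 𝒰

/-- An open cover of `X` is a `γ`-cover if it is infinite and every point of `X` is in all but
finitely many of its members. -/
def IsGammaCover {X : Type*} [TopologicalSpace X] (𝒰 : Set (Set X)) : Prop :=
  IsOpenCover 𝒰 ∧ 𝒰.Infinite ∧ ∀ x : X, {U ∈ 𝒰 | x ∉ U}.Finite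

/-- A `γ`-set is a separable metric space in which every `ω`-cover contains a `γ`-subcover. -/
def IsGammaSet (X : Type*) [TopologicalSpace X] : Prop :=
  TopologicalSpace.SeparableSpace X ∧ TopologicalSpace.MetrizableSpace X ∧
    ∀ 𝒰 : Set (Set X), IsOmegaCover 𝒰 → ∃ 𝒱 ⊆ 𝒰, IsGammaCover 𝒱

open Classical in
/-- The characteristic function of `s ⊆ ω`, a point of the Cantor space `2^ω`. -/
noncomputable def charFn (s : Set ℕ) : ℕ → Bool := fun n => decide (n ∈ s)

end GammaBorel

namespace GammaBorel

open Set Filter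
open scoped Ordinal

/-! `DiamondB` enters only through an unbounded family of ℵ₁ functions. By transfinite recursion,
build a ⊆*-decreasing tower whose increasing enumerations dominate these functions; every interval
partition is then missed infinitely often by some tower member, hence by all later ones.

Given an ω-cover, Galvin–Miller attaches to each α cover members that eventually catch each earlier
tower point, and an interval partition such that a set missing the n-th interval lies in the n-th
member. Closing off ω times gives δ for which x_δ misses infinitely many intervals of each partition
along a sequence cofinal in δ. One member from each stage gives the γ-subcover: points before δ are
caught by bookkeeping, all others because they are ⊆* x_δ. -/

theorem countable_Iio_omega1 (α : Omega1) : (Iio α).Countable := by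
  have h := Cardinal.mk_Iio_lt α (by simp)
  rw [Cardinal.mk_toType, Ordinal.card_omega, ← Cardinal.succ_aleph0, Order.lt_succ_iff] at h
  exact Cardinal.le_aleph0_iff_set_countable.1 h

instance : Uncountable Omega1 := by
  rw [← Cardinal.aleph0_lt_mk_iff, Cardinal.mk_toType, Ordinal.card_omega]
  simp

theorem bddAbove_of_countable {s : Set Omega1} (hs : s.Countable) : BddAbove s := by
  by_contra h
  rw [not_bddAbove_iff] at h
  have huniv : (⋃ a ∈ s, Iio a) = univ := by
    refine eq_univ_of_forall fun x ↦ ?_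
    obtain ⟨a, ha, hxa⟩ := h x
    exact mem_biUnion ha hxa
  refine not_countable_univ (α := Omega1) ?_
  rw [← huniv]
  exact hs.biUnion fun a _ ↦ countable_Iio_omega1 a

instance : Nonempty Omega1 :=
  Infinite.nonempty Omega1

instance : NoMaxOrder Omega1 where
  exists_gt a := by
    by_contra! h
    refine not_countable_univ (α := Omega1) ?_
    refine ((countable_Iio_omega1 a).insert a).mono fun x _ ↦ ?_
    exact (h x).eq_or_lt

theorem isClub_Ioi (a : Omega1) : IsClub (Ioi a) where
  dirSupClosed := by
    rintro t ht ⟨b, hb⟩ - x hx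
    exact (ht hb).trans_le (hx.1 hb)
  isCofinal x := by
    obtain ⟨b, hb⟩ := exists_gt (max a x)
    exact ⟨b, (le_max_left _ _).trans_lt hb, (le_max_right _ _).trans hb.le⟩

/-- `◇(𝔟)` implies that some family of `ℵ₁` functions is unbounded, that is, `𝔟 = ℵ₁`. -/
theorem DiamondB.exists_unbounded (h : DiamondB) :
    ∃ g : Omega1 → ℕ → ℕ, ∀ r : ℕ → ℕ, ∃ α, ∃ᶠ n in atTop, r n < g α n := by
  classical
  have c : ℕ ↪ Omega1 := Infinite.natEmbedding Omega1
  have e : (ℕ → Bool) ≃ᵐ (ℕ → ℕ) :=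
    PolishSpace.measurableEquivOfNotCountable
      (by simp [← Cardinal.mk_le_aleph0_iff, Cardinal.aleph0_lt_continuum])
      (by simp [← Cardinal.mk_le_aleph0_iff, Cardinal.aleph0_lt_continuum])
  -- A Borel isomorphism decodes a real from ω fixed coordinates; the default `0` occurs only for δ
  -- not above all of them.
  let F : (δ : Omega1) → (Iio δ → Bool) → ℕ → ℕ := fun δ s ↦
    if hδ : ∀ n, c n < δ then e fun n ↦ s ⟨c n, hδ n⟩ else 0
  have hF : ∀ δ, Measurable (F δ) := by
    intro δ
    by_cases hδ : ∀ n, c n < δ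
    · simp only [F, dif_pos hδ]
      exact e.measurable.comp (measurable_pi_lambda _ fun n ↦ measurable_pi_apply _)
    · simp only [F, dif_neg hδ]
      exact measurable_const
  obtain ⟨g, hg⟩ := h F hF
  refine ⟨g, fun r ↦ ?_⟩
  obtain ⟨b, hb⟩ := bddAbove_of_countable (countable_range c)
  -- Of stationarity, only meeting the tail `Ioi b` is needed.
  obtain ⟨δ, hδ, hbδ⟩ := hg (Function.extend c (e.symm r) fun _ ↦ false) (isClub_Ioi b)
  refine ⟨δ, Nat.frequently_atTop_iff_infinite.2 ?_⟩
  have hcδ : ∀ n, c n < δ := fun n ↦ (hb (mem_range_self n)).trans_lt hbδ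
  simpa [F, hcδ, c.injective.extend_apply] using hδ

/-! ### Towers with fast-growing enumerations -/

theorem exists_pseudointersection {ι : Type*} [LinearOrder ι] [Countable ι] {p : ι → ℕ → ℕ}
    (hp : ∀ i, StrictMono (p i)) (hmod : ∀ i j, i < j → (range (p j) \ range (p i)).Finite)
    (g : ℕ → ℕ) :
    ∃ q : ℕ → ℕ, StrictMono q ∧ g ≤ q ∧
      ∀ i, (range q \ range (p i)).Finite ∧ (range (p i) \ range q).Infinite := by
  obtain ⟨e, he⟩ := exists_injective_nat ι
  have hfin : ∀ n, {i | e i ≤ n}.Finite := fun n ↦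
    (finite_Iic n).preimage he.injOn
  have hinf : ∀ n, {m | ∀ i, e i ≤ n → m ∈ range (p i)}.Infinite := by
    intro n
    rcases {i | e i ≤ n}.eq_empty_or_nonempty with h0 | h0
    · have : {m | ∀ i, e i ≤ n → m ∈ range (p i)} = univ :=
        eq_univ_of_forall fun m i hi ↦ (h0.subset hi).elim
      rw [this]
      exact infinite_univ
    · obtain ⟨j, hj, hmax⟩ := exists_max_image _ id (hfin n) h0
      have hbad : (⋃ i ∈ {i | e i ≤ n}, range (p j) \ range (p i)).Finite := by
        refine (hfin n).biUnion fun i hi ↦ ?_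
        rcases (hmax i hi).eq_or_lt with h | h
        · obtain rfl : i = j := h
          simp
        · exact hmod i j h
      refine ((infinite_range_of_injective (hp j).injective).sdiff hbad).mono ?_
      rintro m ⟨hm, hm'⟩ i hi
      by_contra h
      exact hm' (mem_biUnion hi ⟨hm, h⟩)
  have hnext : ∀ n b, ∃ m, b < m ∧ ∀ i, e i ≤ n → m ∈ range (p i) := fun n b ↦ by
    obtain ⟨m, hm, hbm⟩ := (hinf n).exists_gt b
    exact ⟨m, hbm, hm⟩
  choose f hf hfp using hnext
  -- Only the even terms form `q`, hence the index `(n + 1) / 2`; the odd terms witness that each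
  -- `range (p i) \ range q` is infinite.
  let r : ℕ → ℕ := Nat.rec (f 0 (g 0)) fun n b ↦ f (n + 1) (max b (g ((n + 1) / 2)))
  have hr : StrictMono r := strictMono_nat_of_lt_succ fun n ↦
    (le_max_left _ _).trans_lt (hf (n + 1) (max (r n) (g ((n + 1) / 2))))
  have hrg : ∀ n, g (n / 2) ≤ r n := by
    rintro (_ | n)
    · exact (hf 0 (g 0)).le
    · exact (le_max_right _ _).trans (hf (n + 1) (max (r n) (g ((n + 1) / 2)))).le
  have hrp : ∀ n i, e i ≤ n → r n ∈ range (p i) := by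
    rintro (_ | n) i hi
    · exact hfp 0 (g 0) i hi
    · exact hfp (n + 1) (max (r n) (g ((n + 1) / 2))) i hi
  refine ⟨fun n ↦ r (2 * n), fun a b hab ↦ hr (by lia), fun n ↦ ?_, fun i ↦ ⟨?_, ?_⟩⟩
  · simpa using hrg (2 * n)
  · refine ((finite_Iio (e i)).image fun n ↦ r (2 * n)).subset ?_
    rintro _ ⟨⟨n, rfl⟩, hn⟩
    refine ⟨n, ?_, rfl⟩
    by_contra h
    simp only [mem_Iio, not_lt] at h
    exact hn (hrp _ i (by lia))
  · have hinj : Function.Injective fun n ↦ r (2 * (n + e i) + 1) := fun a b hab ↦ by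
      have : 2 * (a + e i) + 1 = 2 * (b + e i) + 1 := hr.injective hab
      lia
    refine (infinite_range_of_injective hinj).mono ?_
    rintro _ ⟨n, rfl⟩
    refine ⟨hrp (2 * (n + e i) + 1) i (by lia), ?_⟩
    rintro ⟨m, hm⟩
    have : 2 * m = 2 * (n + e i) + 1 := hr.injective hm
    lia

theorem exists_tower {Ω : Type*} [LinearOrder Ω] [WellFoundedLT Ω]
    (hΩ : ∀ α : Ω, (Iio α).Countable) (g : Ω → ℕ → ℕ) :
    ∃ p : Ω → ℕ → ℕ, (∀ α, StrictMono (p α)) ∧ (∀ α, g α ≤ p α) ∧ ∀ α β, α < β →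
      (range (p β) \ range (p α)).Finite ∧ (range (p α) \ range (p β)).Infinite := by
  have step : ∀ (α : Ω) (p : Iio α → ℕ → ℕ), ∃ q : ℕ → ℕ, (∀ i, StrictMono (p i)) →
      (∀ i j, i < j → (range (p j) \ range (p i)).Finite) → StrictMono q ∧ g α ≤ q ∧
      ∀ i, (range q \ range (p i)).Finite ∧ (range (p i) \ range q).Infinite := by
    intro α p
    have := (hΩ α).to_subtype
    by_cases h : (∀ i, StrictMono (p i)) ∧ ∀ i j, i < j → (range (p j) \ range (p i)).Finite
    · obtain ⟨q, hq⟩ := exists_pseudointersection h.1 h.2 (g α)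
      exact ⟨q, fun _ _ ↦ hq⟩
    · exact ⟨0, fun h₁ h₂ ↦ (h ⟨h₁, h₂⟩).elim⟩
  choose s hs using step
  let p : Ω → ℕ → ℕ := wellFounded_lt.fix fun α ih ↦ s α fun i ↦ ih i i.2
  have hps : ∀ α, p α = s α fun i ↦ p i := fun α ↦ wellFounded_lt.fix_eq _ α
  have key : ∀ α, StrictMono (p α) ∧ g α ≤ p α ∧ ∀ i : Iio α,
      (range (p α) \ range (p i)).Finite ∧ (range (p i) \ range (p α)).Infinite := by
    intro α
    induction α using WellFoundedLT.induction with
    | ind α ih =>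
      have := hs α (fun i ↦ p i) (fun i ↦ (ih i i.2).1)
        fun i j hij ↦ ((ih j j.2).2.2 ⟨i, hij⟩).1
      rwa [← hps] at this
  exact ⟨p, fun α ↦ (key α).1, fun α ↦ (key α).2.1, fun α β h ↦ (key β).2.2 ⟨α, h⟩⟩

/-- Each interval from the `N`-th on contributes at least one new value of `p`. -/
theorem lt_of_forall_inter_Ico_nonempty {p a : ℕ → ℕ} (hp : StrictMono p) {N : ℕ}
    (h : ∀ n, N ≤ n → (range p ∩ Ico (a n) (a (n + 1))).Nonempty) (n : ℕ) :
    p n < a (N + n + 1) := by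
  induction n with
  | zero =>
    obtain ⟨_, ⟨i, rfl⟩, hi⟩ := h N le_rfl
    exact (hp.monotone i.zero_le).trans_lt hi.2
  | succ n ih =>
    obtain ⟨_, ⟨i, rfl⟩, hi⟩ := h (N + n + 1) (by lia)
    exact (hp.monotone (hp.lt_iff_lt.1 (ih.trans_le hi.1))).trans_lt hi.2

theorem exists_frequently_disjoint_Ico {Ω : Type*} {p g : Ω → ℕ → ℕ} (hp : ∀ α, StrictMono (p α))
    (hgp : ∀ α, g α ≤ p α) (hg : ∀ r : ℕ → ℕ, ∃ α, ∃ᶠ n in atTop, r n < g α n) {a : ℕ → ℕ}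
    (ha : StrictMono a) : ∃ α, ∃ᶠ n in atTop, Disjoint (range (p α)) (Ico (a n) (a (n + 1))) := by
  -- The index `2 * n + 1` is at least `N + n + 1` once `n ≥ N`, whatever `N` is.
  obtain ⟨α, hα⟩ := hg fun n ↦ a (2 * n + 1)
  refine ⟨α, fun h ↦ ?_⟩
  obtain ⟨N, hN⟩ := eventually_atTop.1 h
  obtain ⟨n, hn, hlt⟩ := (frequently_atTop.1 hα) N
  have h₁ := lt_of_forall_inter_Ico_nonempty (hp α)
    (fun n hn ↦ not_disjoint_iff_nonempty_inter.1 (hN n hn)) n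
  have h₂ : a (N + n + 1) ≤ a (2 * n + 1) := ha.monotone (by lia)
  exact absurd (hlt.trans_le (hgp α n)) (by lia)

/-! ### Covers and the selection of a γ-subcover -/

theorem charFn_injective : Function.Injective charFn := fun s t h ↦ by
  ext n
  simpa [charFn] using congrFun h n

theorem IsGammaCover.of_eventually_mem {X : Type*} [TopologicalSpace X] {V : ℕ → Set X}
    (hopen : ∀ k, IsOpen (V k)) (huniv : ∀ k, V k ≠ univ) (hmem : ∀ x, ∀ᶠ k in atTop, x ∈ V k) :
    IsGammaCover (range V) := by
  refine ⟨⟨forall_mem_range.2 hopen, ?_⟩, fun hfin ↦ ?_, fun x ↦ ?_⟩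
  · refine eq_univ_of_forall fun x ↦ ?_
    obtain ⟨k, hk⟩ := (hmem x).exists
    exact ⟨V k, mem_range_self k, hk⟩
  · have := hfin.to_subtype
    -- Were the range finite, one member would recur infinitely often and so contain every point.
    obtain ⟨⟨U, k₀, rfl⟩, hU⟩ := Finite.exists_infinite_fiber (rangeFactorization V)
    refine huniv k₀ (eq_univ_of_forall fun x ↦ ?_)
    obtain ⟨k, hk, hxk⟩ := ((Nat.frequently_atTop_iff_infinite.2
      (infinite_coe_iff.1 hU)).and_eventually (hmem x)).exists
    have hk : V k = V k₀ := congrArg Subtype.val hk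
    rwa [← hk]
  · obtain ⟨N, hN⟩ := eventually_atTop.1 (hmem x)
    refine ((finite_Iio N).image V).subset ?_
    rintro _ ⟨⟨k, rfl⟩, hk⟩
    exact ⟨k, not_le.1 fun h ↦ hk (hN k h), rfl⟩

theorem exists_forall_eq_imp_mem {X : Set (ℕ → Bool)} {U : Set X} (hU : IsOpen U) {x : X}
    (hx : x ∈ U) : ∃ k, ∀ y : X, (∀ i < k, y.1 i = x.1 i) → y ∈ U := by
  obtain ⟨W, hW, rfl⟩ := isOpen_induced_iff.1 hU
  obtain ⟨I, u, hu, hIW⟩ := isOpen_pi_iff.1 hW x.1 hx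
  refine ⟨I.sup id + 1, fun y hy ↦ hIW fun i hi ↦ ?_⟩
  rw [hy i (Nat.lt_succ_of_le (Finset.le_sup (f := id) hi))]
  exact (hu i hi).2

/-- A member of an `ω`-cover of a space containing the finite sets contains, for a suitable `m'`,
all points that are disjoint from the interval `[m, m')`. -/
theorem IsOmegaCover.exists_mem_forall_disjoint_Ico {X : Set (ℕ → Bool)}
    (hX : ∀ s : Set ℕ, s.Finite → charFn s ∈ X) {𝒰 : Set (Set X)} (h𝒰 : IsOmegaCover 𝒰)
    {T : Set X} (hT : T.Finite) (m : ℕ) :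
    ∃ U ∈ 𝒰, T ⊆ U ∧ ∃ m', m < m' ∧
      ∀ s (hs : charFn s ∈ X), Disjoint s (Ico m m') → (⟨charFn s, hs⟩ : X) ∈ U := by
  let pt : Finset ℕ → X := fun s ↦ ⟨charFn s, hX s s.finite_toSet⟩
  -- `U` contains all subsets of `m`; `m'` exceeds the finitely many coordinates deciding this, so a
  -- set missing `[m, m')` looks like its trace on `m`.
  obtain ⟨U, hU, hTU⟩ := h𝒰.2.1 (T ∪ pt '' (Finset.range m).powerset)
    (hT.union ((Finset.finite_toSet _).image pt))
  have hopen := h𝒰.1.1 U hU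
  have hnhds : ∀ s : Finset ℕ, ∃ k, s ∈ (Finset.range m).powerset →
      ∀ y : X, (∀ i < k, y.1 i = charFn s i) → y ∈ U := by
    intro s
    by_cases hs : s ∈ (Finset.range m).powerset
    · obtain ⟨k, hk⟩ := exists_forall_eq_imp_mem hopen (hTU (.inr (mem_image_of_mem pt hs)))
      exact ⟨k, fun _ ↦ hk⟩
    · exact ⟨0, fun h ↦ (hs h).elim⟩
  choose k hk using hnhds
  refine ⟨U, hU, subset_union_left.trans hTU, max (m + 1) ((Finset.range m).powerset.sup k),
    by lia, fun s hs hdisj ↦ ?_⟩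
  classical
  have hmem : {i ∈ Finset.range m | i ∈ s} ∈ (Finset.range m).powerset :=
    Finset.mem_powerset.2 (Finset.filter_subset _ _)
  refine hk _ hmem _ fun i hi ↦ ?_
  have hi' : i < max (m + 1) ((Finset.range m).powerset.sup k) :=
    (hi.trans_le (Finset.le_sup hmem)).trans_le (le_max_right _ _)
  by_cases him : i < m
  · simp [charFn, him]
  · have : i ∉ s := fun h ↦ disjoint_left.1 hdisj h ⟨not_lt.1 him, hi'⟩
    simp [charFn, this]

/-- The Galvin–Miller lemma. -/
theorem IsOmegaCover.exists_seq_forall_disjoint_Ico {X : Set (ℕ → Bool)}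
    (hX : ∀ s : Set ℕ, s.Finite → charFn s ∈ X) {𝒰 : Set (Set X)} (h𝒰 : IsOmegaCover 𝒰)
    {C : Set X} (hC : C.Countable) :
    ∃ (U : ℕ → Set X) (a : ℕ → ℕ), StrictMono a ∧ (∀ n, U n ∈ 𝒰) ∧
      (∀ c ∈ C, ∀ᶠ n in atTop, c ∈ U n) ∧
      ∀ n s (hs : charFn s ∈ X), Disjoint s (Ico (a n) (a (n + 1))) →
        (⟨charFn s, hs⟩ : X) ∈ U n := by
  have : Nonempty X := ⟨⟨_, hX ∅ finite_empty⟩⟩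
  obtain ⟨y, hy⟩ := countable_iff_exists_subset_range.1 hC
  choose U hU hyU m' hm' hdisj using fun n m ↦
    h𝒰.exists_mem_forall_disjoint_Ico hX ((finite_Iic n).image y) m
  let a : ℕ → ℕ := Nat.rec 0 fun n m ↦ m' n m
  refine ⟨fun n ↦ U n (a n), a, strictMono_nat_of_lt_succ fun n ↦ hm' n (a n),
    fun n ↦ hU n (a n), fun c hc ↦ ?_, fun n ↦ hdisj n (a n)⟩
  obtain ⟨j, rfl⟩ := hy hc
  exact eventually_atTop.2 ⟨j, fun n hn ↦ hyU n (a n) (mem_image_of_mem y hn)⟩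

theorem eventually_disjoint_Ici {s : Set ℕ} (hs : s.Finite) :
    ∀ᶠ n in atTop, Disjoint s (Ici n) := by
  obtain ⟨b, hb⟩ := hs.bddAbove
  refine eventually_atTop.2 ⟨b + 1, fun n hn ↦ disjoint_left.2 fun i hi hni ↦ ?_⟩
  have := hb hi
  simp only [mem_Ici] at hni
  lia

theorem frequently_disjoint_Ico_of_diff_finite {s t : Set ℕ} (hst : (s \ t).Finite) {a : ℕ → ℕ}
    (ha : StrictMono a) (ht : ∃ᶠ n in atTop, Disjoint t (Ico (a n) (a (n + 1)))) :
    ∃ᶠ n in atTop, Disjoint s (Ico (a n) (a (n + 1))) := by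
  refine (ht.and_eventually (ha.tendsto_atTop.eventually (eventually_disjoint_Ici hst))).mono ?_
  rintro n ⟨h₁, h₂⟩
  exact (h₁.union_left (h₂.mono_right Ico_subset_Ici_self)).mono_left fun i hi ↦ by
    by_cases h : i ∈ t
    exacts [.inl h, .inr ⟨hi, h⟩]

/-- If an `ω₁`-sequence of subsets of `ω`, decreasing modulo finite, is unbounded in the sense that
for each interval partition one of its members misses infinitely many intervals, then together with
the finite sets it forms a `γ`-set. -/
theorem isGammaSet_of_unbounded_tower {x : Omega1 → Set ℕ}
    (hx : ∀ α β, α < β → (x β \ x α).Finite)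
    (hunb : ∀ a : ℕ → ℕ, StrictMono a →
      ∃ α, ∃ᶠ n in atTop, Disjoint (x α) (Ico (a n) (a (n + 1)))) :
    IsGammaSet (charFn '' ({s : Set ℕ | s.Finite} ∪ range x)) := by
  set X := charFn '' ({s : Set ℕ | s.Finite} ∪ range x)
  refine ⟨inferInstance, inferInstance, fun 𝒰 h𝒰 ↦ ?_⟩
  have hX : ∀ s : Set ℕ, s.Finite → charFn s ∈ X := fun s hs ↦ mem_image_of_mem _ (.inl hs)
  let pt : Omega1 → X := fun α ↦ ⟨charFn (x α), mem_image_of_mem _ (.inr (mem_range_self α))⟩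
  have hx' : ∀ α β, α ≤ β → (x β \ x α).Finite := fun α β h ↦ by
    rcases h.eq_or_lt with rfl | h
    · simp
    · exact hx α β h
  choose U a ha hU hlt hdisj using fun α : Omega1 ↦
    h𝒰.exists_seq_forall_disjoint_Ico hX ((countable_Iio_omega1 α).image pt)
  have hnext : ∀ α, ∃ β, α < β ∧
      ∃ᶠ n in atTop, Disjoint (x β) (Ico (a α n) (a α (n + 1))) := fun α ↦ by
    obtain ⟨γ, hγ⟩ := hunb (a α) (ha α)
    obtain ⟨β, hβ⟩ := exists_gt (max α γ)
    exact ⟨β, (le_max_left _ _).trans_lt hβ, frequently_disjoint_Ico_of_diff_finite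
      (hx γ β ((le_max_right _ _).trans_lt hβ)) (ha α) hγ⟩
  choose φ hφ hφx using hnext
  let A : ℕ → Omega1 := Nat.rec (Classical.arbitrary Omega1) fun _ α ↦ φ α
  have hA : StrictMono A := strictMono_nat_of_lt_succ fun k ↦ hφ (A k)
  -- δ is the supremum of the `A k`, so each β < δ is eventually below them.
  obtain ⟨δ, hδ, hδmin⟩ := wellFounded_lt.has_min (upperBounds (range A))
    (bddAbove_of_countable (countable_range A))
  have hAδ : ∀ k, A k ≤ δ := fun k ↦ hδ (mem_range_self k)
  have hltA : ∀ β < δ, ∃ k, β < A k := fun β hβ ↦ by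
    by_contra! h
    exact hδmin β (forall_mem_range.2 h) hβ
  obtain ⟨z, hz⟩ := countable_iff_exists_subset_range.1 (countable_Iio_omega1 δ)
  have hsel : ∀ k, ∃ n, Disjoint (x δ) (Ico (a (A k) n) (a (A k) (n + 1))) ∧ k ≤ a (A k) n ∧
      ∀ j ∈ Iic k, z j < A k → pt (z j) ∈ U (A k) n := fun k ↦ by
    have h₁ : ∃ᶠ n in atTop, Disjoint (x δ) (Ico (a (A k) n) (a (A k) (n + 1))) :=
      frequently_disjoint_Ico_of_diff_finite (hx' _ _ (hAδ (k + 1))) (ha _) (hφx (A k))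
    have h₂ : ∀ᶠ n in atTop, k ≤ a (A k) n :=
      (ha _).tendsto_atTop.eventually (eventually_ge_atTop k)
    have h₃ : ∀ᶠ n in atTop, ∀ j ∈ Iic k, z j < A k → pt (z j) ∈ U (A k) n :=
      (finite_Iic k).eventually_all.2 fun j _ ↦ eventually_imp_distrib_left.2 fun hj ↦
        hlt (A k) _ (mem_image_of_mem pt hj)
    exact (h₁.and_eventually (h₂.and h₃)).exists
  choose N hNδ hNk hNz using hsel
  let V : ℕ → Set X := fun k ↦ U (A k) (N k)
  have hV : ∀ k, V k ∈ 𝒰 := fun k ↦ hU (A k) (N k)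
  refine ⟨range V, range_subset_iff.2 hV, .of_eventually_mem (fun k ↦ h𝒰.1.1 _ (hV k))
    (fun k h ↦ h𝒰.2.2 (h ▸ hV k)) ?_⟩
  -- Since `k ≤ a (A k) (N k)`, the chosen intervals eventually avoid the finite set `s \ x δ`.
  have hfin : ∀ s (hs : charFn s ∈ X), (s \ x δ).Finite →
      ∀ᶠ k in atTop, (⟨charFn s, hs⟩ : X) ∈ V k := fun s hs hsδ ↦ by
    filter_upwards [eventually_disjoint_Ici hsδ] with k hk
    have hk' : Disjoint (s \ x δ) (Ico (a (A k) (N k)) (a (A k) (N k + 1))) :=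
      hk.mono_right (Ico_subset_Ici_self.trans (Ici_subset_Ici.2 (hNk k)))
    refine hdisj (A k) (N k) s hs (((hNδ k).union_left hk').mono_left fun i hi ↦ ?_)
    by_cases h : i ∈ x δ
    exacts [.inl h, .inr ⟨hi, h⟩]
  rintro ⟨_, s, hs | ⟨β, rfl⟩, rfl⟩
  · exact hfin s _ (hs.subset sdiff_subset)
  · rcases le_or_gt δ β with h | h
    · exact hfin _ _ (hx' δ β h)
    · obtain ⟨j, rfl⟩ := hz h
      obtain ⟨K, hK⟩ := hltA _ h
      filter_upwards [eventually_ge_atTop (max j K)] with k hk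
      exact hNz k j ((le_max_left _ _).trans hk)
        (hK.trans_le (hA.monotone ((le_max_right _ _).trans hk)))

end GammaBorel

theorem mainTheorem4 (h : GammaBorel.DiamondB) :
    ∃ x : GammaBorel.Omega1 → Set ℕ,
      (∀ α, (x α).Infinite) ∧
      (∀ α β, α < β → (x β \ x α).Finite) ∧
      ∃ X : Set (ℕ → Bool),
        X = GammaBorel.charFn '' ({s : Set ℕ | s.Finite} ∪ Set.range x) ∧
        ¬ X.Countable ∧
        GammaBorel.IsGammaSet X := by
  obtain ⟨g, hg⟩ := h.exists_unbounded
  obtain ⟨p, hp, hgp, hpmod⟩ := GammaBorel.exists_tower GammaBorel.countable_Iio_omega1 g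
  refine ⟨fun α ↦ Set.range (p α), fun α ↦ Set.infinite_range_of_injective (hp α).injective,
    fun α β hαβ ↦ (hpmod α β hαβ).1, _, rfl, fun hX ↦ ?_,
    GammaBorel.isGammaSet_of_unbounded_tower (fun α β hαβ ↦ (hpmod α β hαβ).1) fun a ha ↦
      GammaBorel.exists_frequently_disjoint_Ico hp hgp hg ha⟩
  have hne : ∀ α β, α < β → Set.range (p α) ≠ Set.range (p β) := fun α β hαβ heq ↦
    (hpmod α β hαβ).2 (by simp [heq])
  have hinj : Function.Injective fun α ↦ Set.range (p α) := fun α β heq ↦ by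
    rcases lt_trichotomy α β with hlt | rfl | hgt
    exacts [(hne α β hlt heq).elim, rfl, (hne β α hgt heq.symm).elim]
  have hrange := (Set.countable_of_injective_of_countable_image
    GammaBorel.charFn_injective.injOn hX).mono Set.subset_union_right
  exact not_countable (α := GammaBorel.Omega1)
    (Set.countable_univ_iff.1 (Set.countable_of_injective_of_countable_image hinj.injOn
      (by rwa [Set.image_univ])))
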